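/- Let $p$ be a prime, $r\ge 1$ an integer, $R=\mathbb{Z}/p^r\mathbb{Z}$ and $I=pR$. For $a\in R$ put $\eta(a)=\begin{pmatrix} a & -1\\ 1 & 0\end{pmatrix}$. For $m\ge 1$ and $1\le \ell\le r$ let $z=(-1)^m+p^\ell\in R$ (a unit of $R$), and let $\sigma_{2m}(\ell)$ be the number of sequences $(c_1,\ldots,c_{2m})\in I^{2m}$ with $$\eta(c_1)\eta(c_2)\cdots\eta(c_{2m})=\begin{pmatrix} z & 0\\ 0 & z^{-1}\end{pmatrix}.$$ For $q\in\mathbb{Q}\setminus\{0,1\}$ and $k\in\mathbb{Z}$ write $[k]_q=\frac{q^k-1}{q-1}$. Then for all $1\le\ell\le r$: $$\sigma_2(\ell)=\delta_{\ell,r},\qquad \sigma_4(\ell)=\begin{cases} 0 & \text{if } \ell=1<r,\\ (\ell-1)(p^r-p^{r-1}) & \text{if } 1<\ell<r,\\ (r-1)p^r-(r-2)p^{r-1} & \text{if } \ell=r, \end{cases}$$ and for every integer $m>2$ $$\sigma_{2m}(\ell)=\begin{cases} 0 & \text{if } \ell=1<r,\\ p^{(2m-3)r-\ell(m-2)+1-m}\,(p^{m-1}-1)\,[\ell-1]_{p^{m-2}}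 & \text{if } 1<\ell<r,\\ p^{(m-1)r}[r-1]_{p^{m-2}}-p^{(m-1)r-1}[r-2]_{p^{m-2}} & \text{if } \ell=r. \end{cases}$$ -/

import Mathlib

namespace Quiddity

/-- The matrix `η(a) = (a, -1; 1, 0)`. -/
def eta {R : Type*} [CommRing R] (a : R) : Matrix (Fin 2) (Fin 2) R :=
  !![a, -1; 1, 0]

/-- The ordered product `η(c₁) η(c₂) ⋯ η(cₙ)`. -/
def etaProd {R : Type*} [CommRing R] {n : ℕ} (c : Fin n → R) : Matrix (Fin 2) (Fin 2) R :=
  (List.ofFn fun i => eta (c i)).prod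

/-- The matrix `λ_a = diag(a, a⁻¹)` for a unit `a`. -/
def lam {R : Type*} [CommRing R] (a : Rˣ) : Matrix (Fin 2) (Fin 2) R :=
  !![(a : R), 0; 0, ((a⁻¹ : Rˣ) : R)]

/-- The sequences `(c₁, …, cₙ)` with entries in the ideal `I` and `η(c₁) ⋯ η(cₙ) = λ_z`. -/
def sigmaSet {R : Type*} [CommRing R] (I : Ideal R) (n : ℕ) (z : R) : Set (Fin n → R) :=
  {c | (∀ i, c i ∈ I) ∧ ∃ u : Rˣ, (u : R) = z ∧ etaProd c = lam u}

/-- The number `σ_n(ℓ)` over `R = ℤ/p^r ℤ`: the number of sequences `(c₁, …, cₙ)` in `(pR)ⁿ`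
with `η(c₁) ⋯ η(cₙ) = λ_z`, where `z = (-1)^(n/2) + p^ℓ` (used for even `n` only). -/
noncomputable def sigma (p r n ℓ : ℕ) : ℕ :=
  (sigmaSet (R := ZMod (p ^ r)) (Ideal.span {(p : ZMod (p ^ r))}) n
    ((-1) ^ (n / 2) + (p : ZMod (p ^ r)) ^ ℓ)).ncard

/-- The `q`-integer `[k]_q = (q^k - 1) / (q - 1)`, for `q ≠ 1` and an integer `k`. -/
def qInt (q : ℚ) (k : ℤ) : ℚ :=
  (q ^ k - 1) / (q - 1)

end Quiddity

/-! Stripping two factors `η(a)η(b)` from the left replaces the lower right entry `d` of the target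
by `-d - b(β - ad)`, with `β ∈ I` the upper right entry. As `d` is a unit, `v = β - ad` runs over
`I` when `a` does. So, up to signs, each pair of letters amounts to a free pair `(b, v) ∈ I²` that
changes `d` by a product, and the last pair is forced. Hence `σ_{2m}(ℓ)` counts pairs of vectors in
`I^(m-1)` with dot product `(-1)^m z⁻¹ - 1`, a unit times `p^ℓ` (`wordCount_two_mul_add_two`).

To count these, sort the first vector `a` by the largest `j` with all entries in `p^j R`. For `a ≠
0` the map `v ↦ a · v` has image `p^(j+1) R`, so all nonempty fibres have equal size
(`card_fiber_dotHom`). Summing over `j < ℓ` gives a geometric series; `a = 0` contributes only for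
`ℓ = r`. -/

namespace Quiddity

open Finset

/-! ### From matrix products to dot products -/

section Ring

open scoped Classical

variable {R : Type*} [CommRing R]

/-- The inverse of `η(a)`. -/
def etaInv (a : R) : Matrix (Fin 2) (Fin 2) R :=
  !![0, 1; -1, a]

theorem eta_mul_eq_iff (a : R) (X G : Matrix (Fin 2) (Fin 2) R) :
    eta a * X = G ↔ X = etaInv a * G := by
  have h₁ : etaInv a * eta a = 1 := by
    ext i j
    fin_cases i <;> fin_cases j <;> simp [etaInv, eta, Matrix.mul_apply, Fin.sum_univ_two]
  have h₂ : eta a * etaInv a = 1 := by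
    ext i j
    fin_cases i <;> fin_cases j <;> simp [etaInv, eta, Matrix.mul_apply, Fin.sum_univ_two]
  constructor
  · rintro rfl
    rw [← mul_assoc, h₁, one_mul]
  · rintro rfl
    rw [← mul_assoc, h₂, one_mul]

theorem etaInv_mul_etaInv_mul (a b : R) (G : Matrix (Fin 2) (Fin 2) R) :
    etaInv b * (etaInv a * G) = !![-G 0 0 + a * G 1 0, -G 0 1 + a * G 1 1;
      -G 1 0 + b * (-G 0 0 + a * G 1 0), -G 1 1 + b * (-G 0 1 + a * G 1 1)] := by
  ext i j
  fin_cases i <;> fin_cases j <;>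
    simp [etaInv, Matrix.vecMul, dotProduct, Fin.sum_univ_two]

theorem etaProd_cons {n : ℕ} (a : R) (c : Fin n → R) :
    etaProd (Fin.cons a c : Fin (n + 1) → R) = eta a * etaProd c := by
  simp [etaProd, List.ofFn_succ]

variable [Fintype R]

/-- The number of sequences in `I` of length `n` whose `η`-product is `G`. -/
noncomputable def wordCount (I : Ideal R) (n : ℕ) (G : Matrix (Fin 2) (Fin 2) R) : ℕ :=
  ∑ c : Fin n → I, if etaProd (fun i => (c i : R)) = G then 1 else 0

/-- The number of pairs of vectors in `I ^ k` whose dot product is `t`. -/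
noncomputable def dotCount (I : Ideal R) (k : ℕ) (t : R) : ℕ :=
  ∑ a : Fin k → I, ∑ v : Fin k → I, if ∑ i, (a i : R) * v i = t then 1 else 0

theorem sum_fin_succ_fun {α : Type*} [Fintype α] {n : ℕ} (f : (Fin (n + 1) → α) → ℕ) :
    ∑ c, f c = ∑ a : α, ∑ c : Fin n → α, f (Fin.cons a c) := by
  rw [← Fintype.sum_prod_type']
  exact (Fintype.sum_equiv (Fin.consEquiv fun _ => α) _ _ fun _ => rfl).symm

theorem wordCount_succ (I : Ideal R) (n : ℕ) (G : Matrix (Fin 2) (Fin 2) R) :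
    wordCount I (n + 1) G = ∑ a : I, wordCount I n (etaInv (a : R) * G) := by
  unfold wordCount
  rw [sum_fin_succ_fun]
  refine sum_congr rfl fun a _ => sum_congr rfl fun c _ => ?_
  have : (fun i => ((Fin.cons a c : Fin (n + 1) → I) i : R))
      = Fin.cons (a : R) (fun i => (c i : R)) := by
    funext i
    refine Fin.cases ?_ (fun i => ?_) i <;> simp
  rw [this, etaProd_cons]
  simp only [eta_mul_eq_iff]

theorem dotCount_succ (I : Ideal R) (k : ℕ) (t : R) :
    dotCount I (k + 1) t = ∑ b : I, ∑ v : I, dotCount I k (t - b * v) := by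
  unfold dotCount
  rw [sum_fin_succ_fun]
  refine sum_congr rfl fun b _ => ?_
  simp_rw [sum_fin_succ_fun]
  rw [sum_comm]
  refine sum_congr rfl fun v _ => sum_congr rfl fun a _ => sum_congr rfl fun w _ => ?_
  simp only [Fin.sum_univ_succ, Fin.cons_zero, Fin.cons_succ, eq_sub_iff_add_eq']

theorem dotCount_zero (I : Ideal R) (t : R) :
    dotCount I 0 t = if t = 0 then 1 else 0 := by
  simp [dotCount, eq_comm]

/-- If `δ` is a unit and `β ∈ I`, then `a ↦ β - a δ` permutes `I`. -/
theorem sum_sub_mul_unit (I : Ideal R) {β δ : R} (hβ : β ∈ I) (hδ : IsUnit δ) (f : R → ℕ) :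
    ∑ a : I, f (β - a * δ) = ∑ v : I, f v := by
  have hmem : ∀ a : I, β - a * δ ∈ I := fun a => I.sub_mem hβ (I.mul_mem_right _ a.2)
  refine Fintype.sum_bijective (fun a : I => (⟨β - a * δ, hmem a⟩ : I)) ?_ _ _ fun _ => rfl
  refine Finite.injective_iff_bijective.mp fun a b hab => ?_
  have h : β - (a : R) * δ = β - b * δ := congrArg Subtype.val hab
  exact Subtype.ext (hδ.mul_right_cancel (sub_right_injective h))

/-- Induction on pairs of letters, for all `G` of determinant 1 that are suitably diagonal modulo
`I`: this class is stable under stripping a pair, and only `G 1 1` matters for the count. -/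
theorem wordCount_two_mul_add_two (I : Ideal R) (hI : ∀ x ∈ I, IsUnit (1 + x)) (m : ℕ) :
    ∀ G : Matrix (Fin 2) (Fin 2) R, G.det = 1 → G 0 1 ∈ I → G 1 0 ∈ I →
      (-1) ^ (m + 1) * G 1 1 - 1 ∈ I →
      wordCount I (2 * (m + 1)) G = dotCount I m ((-1) ^ (m + 1) * G 1 1 - 1) := by
  induction m with
  | zero =>
    intro G hG h01 h10 h11
    rw [show 2 * (0 + 1) = 0 + 1 + 1 from rfl, wordCount_succ]
    simp_rw [wordCount_succ]
    rw [dotCount_zero]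
    -- The off-diagonal entries force both letters. What remains is `G 1 1 = -1`; the determinant
    -- takes care of `G 0 0`.
    have key : ∀ a b : I, wordCount I 0 (etaInv (b : R) * (etaInv (a : R) * G)) =
        if a = ⟨- G 0 1, I.neg_mem h01⟩ then
          if b = ⟨G 1 0, h10⟩ then (if (-1) ^ (0 + 1) * G 1 1 - 1 = 0 then 1 else 0) else 0
        else 0 := by
      intro a b
      have hdet : G 0 0 * G 1 1 - G 0 1 * G 1 0 = 1 := by rw [← hG, Matrix.det_fin_two]
      rw [etaInv_mul_etaInv_mul, ← ite_and, ← ite_and]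
      simp only [wordCount, univ_unique, sum_singleton]
      refine if_congr ?_ rfl rfl
      rw [etaProd, List.ofFn_zero, List.prod_nil, Matrix.one_fin_two, Subtype.ext_iff,
        Subtype.ext_iff]
      simp only [EmbeddingLike.apply_eq_iff_eq, Matrix.vecCons_inj, and_true]
      constructor
      · rintro ⟨⟨h1, h2⟩, h3, h4⟩
        rw [← h2, mul_zero, add_zero] at h4
        rw [← h1, mul_one] at h3
        exact ⟨⟨by linear_combination h2 + a * h4, by linear_combination -h3⟩,
          by linear_combination -h4⟩
      · rintro ⟨⟨ha, hb⟩, h⟩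
        have h11' : G 1 1 = -1 := by linear_combination -h
        rw [h11'] at hdet ⊢
        rw [ha, hb]
        refine ⟨⟨?_, ?_⟩, ?_, ?_⟩
        · linear_combination -hdet
        · ring
        · linear_combination -G 1 0 * hdet
        · ring
    simp_rw [key]
    simp
  | succ m ih =>
    intro G hG h01 h10 h11
    have hδ : IsUnit (G 1 1) := by
      have := hI _ h11
      rw [add_sub_cancel] at this
      exact isUnit_of_mul_isUnit_right this
    rw [show 2 * (m + 1 + 1) = 2 * (m + 1) + 1 + 1 from rfl, wordCount_succ]
    simp_rw [wordCount_succ]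
    have key : ∀ a b : I, wordCount I (2 * (m + 1)) (etaInv (b : R) * (etaInv (a : R) * G)) =
        dotCount I m ((-1) ^ (m + 1 + 1) * G 1 1 - 1 - 
          b * (-(-1) ^ (m + 1 + 1) * (G 0 1 - a * G 1 1))) := by
      intro a b
      have e : (-1) ^ (m + 1) * (-G 1 1 + b * (-G 0 1 + a * G 1 1)) - 1 =
          (-1) ^ (m + 1 + 1) * G 1 1 - 1 - b * (-(-1) ^ (m + 1 + 1) * (G 0 1 - a * G 1 1)) := by
        ring
      rw [ih]
      · rw [etaInv_mul_etaInv_mul]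
        exact congrArg _ e
      · rw [Matrix.det_mul, Matrix.det_mul, hG]
        simp [etaInv]
      · rw [etaInv_mul_etaInv_mul]
        exact I.add_mem (I.neg_mem h01) (I.mul_mem_right _ a.2)
      · rw [etaInv_mul_etaInv_mul]
        exact I.add_mem (I.neg_mem h10) (I.mul_mem_right _ b.2)
      · rw [etaInv_mul_etaInv_mul]
        change (-1) ^ (m + 1) * (-G 1 1 + b * (-G 0 1 + a * G 1 1)) - 1 ∈ I
        rw [e]
        exact I.sub_mem h11 (I.mul_mem_right _ b.2)
    simp_rw [key]
    rw [sum_comm, dotCount_succ]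
    refine sum_congr rfl fun b _ => ?_
    set ε : R := -(-1) ^ (m + 1 + 1) with hε
    have hεu : IsUnit ε := by
      rw [hε]; exact ((isUnit_one.neg).pow _).neg
    -- For fixed `b`, trade `a` for `v = ε (G 0 1 - a * G 1 1)`, the factor multiplying `b`.
    rw [← sum_sub_mul_unit I (I.mul_mem_left ε h01) (hεu.mul hδ)
      fun v => dotCount I m ((-1) ^ (m + 1 + 1) * G 1 1 - 1 - b * v)]
    refine sum_congr rfl fun a _ => ?_
    congr 2
    ring

end Ring

/-! ### Counting dot products over `ℤ/p^r` -/

section PrimePower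

open scoped Classical

variable {p r : ℕ}

theorem isUnit_of_not_dvd (hp : p.Prime) {y : ZMod (p ^ r)} (hy : ¬ (p : ZMod (p ^ r)) ∣ y) :
    IsUnit y := by
  have : NeZero (p ^ r) := ⟨(pow_pos hp.pos r).ne'⟩
  rw [← ZMod.natCast_zmod_val y, ZMod.isUnit_iff_coprime]
  refine (Nat.Coprime.pow_left r ((hp.coprime_iff_not_dvd).2 fun h => hy ?_)).symm
  rw [← ZMod.natCast_zmod_val y]
  exact Nat.cast_dvd_cast h

theorem card_span_pow (hp : p.Prime) {j : ℕ} (hj : j ≤ r) :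
    Nat.card (Ideal.span {(p : ZMod (p ^ r)) ^ j}) = p ^ (r - j) := by
  have h0 : p ^ r ≠ 0 := (pow_pos hp.pos r).ne'
  have : (Ideal.span {(p : ZMod (p ^ r)) ^ j} : Set (ZMod (p ^ r))) =
      AddSubgroup.zmultiples (((p ^ j : ℕ) : ZMod (p ^ r))) := by
    ext x
    rw [SetLike.mem_coe, SetLike.mem_coe, Ideal.mem_span_singleton', AddSubgroup.mem_zmultiples_iff]
    constructor
    · rintro ⟨a, rfl⟩
      obtain ⟨a, rfl⟩ := ZMod.intCast_surjective a
      exact ⟨a, by simp⟩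
    · rintro ⟨a, rfl⟩
      exact ⟨a, by simp⟩
  rw [← SetLike.coe_sort_coe, this, SetLike.coe_sort_coe, Nat.card_zmultiples,
    ZMod.addOrderOf_coe _ h0, Nat.gcd_eq_right (pow_dvd_pow p hj), Nat.pow_div hj hp.pos]

/-- Comparing cardinalities of the ideals replaces a valuation, and covers `l = r`, where `t = 0`.
-/
theorem pow_mem_span_pow_iff (hp : p.Prime) {j l : ℕ} (hl : l ≤ r) (hj : j ≤ r)
    {t u : ZMod (p ^ r)} (hu : IsUnit u) (ht : t = u * (p : ZMod (p ^ r)) ^ l) :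
    t ∈ Ideal.span {(p : ZMod (p ^ r)) ^ j} ↔ j ≤ l := by
  have : NeZero (p ^ r) := ⟨(pow_pos hp.pos r).ne'⟩
  subst ht
  rw [Ideal.unit_mul_mem_iff_mem _ hu]
  constructor
  · intro h
    have hle : Ideal.span {(p : ZMod (p ^ r)) ^ l} ≤ Ideal.span {(p : ZMod (p ^ r)) ^ j} := by
      rwa [Ideal.span_singleton_le_iff_mem]
    have := Nat.card_mono (Set.toFinite _) hle
    change Nat.card (Ideal.span {(p : ZMod (p ^ r)) ^ l}) ≤
      Nat.card (Ideal.span {(p : ZMod (p ^ r)) ^ j}) at this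
    rw [card_span_pow hp hl, card_span_pow hp hj, Nat.pow_le_pow_iff_right hp.one_lt] at this
    omega
  · intro h
    exact Ideal.mem_span_singleton.2 (pow_dvd_pow _ h)

theorem span_pow_anti {j l : ℕ} (h : j ≤ l) :
    Ideal.span {(p : ZMod (p ^ r)) ^ l} ≤ Ideal.span {(p : ZMod (p ^ r)) ^ j} :=
  Ideal.span_singleton_le_span_singleton.2 (pow_dvd_pow _ h)

theorem fiber_card_mul_range_card {G H : Type*} [AddCommGroup G] [AddCommGroup H] [Finite G]
    (f : G →+ H) (t : H) :
    Nat.card {x // f x = t} * Nat.card f.range =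
      if t ∈ f.range then Nat.card G else 0 := by
  split_ifs with h
  · obtain ⟨x₀, rfl⟩ := h
    rw [← f.ker.card_mul_index, AddSubgroup.index_ker]
    congr 1
    refine Nat.card_congr ⟨fun x => ⟨x - x₀, by simp [f.mem_ker, x.2]⟩,
      fun k => ⟨k + x₀, by simp [f.mem_ker.1 k.2]⟩, fun x => by simp, fun k => by simp⟩
  · have : IsEmpty {x // f x = t} := ⟨fun x => h ⟨x, x.2⟩⟩
    simp

/-- The additive map `v ↦ ∑ aᵢ vᵢ` on `I ^ k`. -/
def dotHom {R : Type*} [CommRing R] (I : Ideal R) {k : ℕ} (a : Fin k → R) : (Fin k → I) →+ R where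
  toFun v := ∑ i, a i * v i
  map_zero' := by simp
  map_add' v w := by simp [mul_add, sum_add_distrib]

theorem mem_range_dotHom (hp : p.Prime) {j k : ℕ}
    (a : Fin k → ZMod (p ^ r)) (ha : ∀ i, a i ∈ Ideal.span {(p : ZMod (p ^ r)) ^ j})
    (ha' : ∃ i, a i ∉ Ideal.span {(p : ZMod (p ^ r)) ^ (j + 1)}) (t : ZMod (p ^ r)) :
    t ∈ (dotHom (Ideal.span {(p : ZMod (p ^ r))}) a).range ↔
      t ∈ Ideal.span {(p : ZMod (p ^ r)) ^ (j + 1)} := by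
  constructor
  · rintro ⟨v, rfl⟩
    change ∑ i, a i * (v i : ZMod (p ^ r)) ∈ _
    refine Ideal.sum_mem _ fun i _ => ?_
    rw [pow_succ, ← Ideal.span_singleton_mul_span_singleton]
    exact Ideal.mul_mem_mul (ha i) (v i).2
  · intro ht
    obtain ⟨i, hi⟩ := ha'
    obtain ⟨y, hy⟩ := Ideal.mem_span_singleton.1 (ha i)
    have hu : IsUnit y := by
      refine isUnit_of_not_dvd hp fun ⟨z, hz⟩ => hi (Ideal.mem_span_singleton.2 ⟨z, ?_⟩)
      rw [hy, hz]; ring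
    obtain ⟨u, rfl⟩ := hu
    obtain ⟨s, rfl⟩ := Ideal.mem_span_singleton.1 ht
    -- One coordinate of exact order `j`, namely `a i = p^j u`, already reaches every multiple of
    -- `p^(j+1)`.
    set w : Ideal.span {(p : ZMod (p ^ r))} := ⟨p * (s * (u⁻¹ : (ZMod (p ^ r))ˣ)),
      Ideal.mem_span_singleton.2 (Dvd.intro _ rfl)⟩ with hw
    refine ⟨Pi.single i w, ?_⟩
    change ∑ i', a i' * ((Pi.single i w : Fin k → Ideal.span {(p : ZMod (p ^ r))}) i' :
      ZMod (p ^ r)) = _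
    rw [Fintype.sum_eq_single i]
    · rw [Pi.single_eq_same, hy]
      linear_combination (p : ZMod (p ^ r)) ^ (j + 1) * s * u.mul_inv
    · intro i' hi'
      simp [Pi.single_eq_of_ne hi']

/-- The part of `dotCount` with all entries of the first vector in `J`. -/
noncomputable def restrictedDotCount {R : Type*} [CommRing R] [Fintype R] (I J : Ideal R)
    (k : ℕ) (t : R) : ℕ :=
  ∑ a : Fin k → I with ∀ i, (a i : R) ∈ J, Nat.card {v // dotHom I (fun i => (a i : R)) v = t}

theorem restrictedDotCount_self {R : Type*} [CommRing R] [Fintype R] (I : Ideal R) (k : ℕ) (t : R) :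
    restrictedDotCount I I k t = dotCount I k t := by
  unfold restrictedDotCount dotCount
  rw [filter_true_of_mem fun a _ i => (a i).2]
  refine sum_congr rfl fun a _ => ?_
  rw [Nat.card_eq_fintype_card, Fintype.card_subtype, card_filter]
  rfl

theorem card_filter_forall_mem {R : Type*} [CommRing R] [Fintype R] {I J : Ideal R} (h : J ≤ I)
    (k : ℕ) : #{a : Fin k → I | ∀ i, (a i : R) ∈ J} = Nat.card J ^ k := by
  have : ({a : Fin k → I | ∀ i, (a i : R) ∈ J} : Finset (Fin k → I)) =
      Fintype.piFinset fun _ => ({x : I | (x : R) ∈ J} : Finset I) := by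
    ext a; simp [Fintype.mem_piFinset]
  rw [this, Fintype.card_piFinset_const, ← Fintype.card_subtype, ← Nat.card_eq_fintype_card]
  congr 1
  exact Nat.card_congr ⟨fun x => ⟨x.1, x.2⟩, fun x => ⟨⟨x.1, h x.2⟩, x.2⟩, fun _ => rfl, fun _ => rfl⟩

theorem card_fiber_dotHom (hp : p.Prime) {j k : ℕ} (hj : j < r)
    (a : Fin k → ZMod (p ^ r)) (ha : ∀ i, a i ∈ Ideal.span {(p : ZMod (p ^ r)) ^ j})
    (ha' : ∃ i, a i ∉ Ideal.span {(p : ZMod (p ^ r)) ^ (j + 1)}) (t : ZMod (p ^ r)) :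
    (Nat.card {v // dotHom (Ideal.span {(p : ZMod (p ^ r))}) a v = t} : ℚ) =
      if t ∈ Ideal.span {(p : ZMod (p ^ r)) ^ (j + 1)} then
        (p : ℚ) ^ ((r - 1) * k) / (p : ℚ) ^ (r - (j + 1)) else 0 := by
  have : NeZero (p ^ r) := ⟨(pow_pos hp.pos r).ne'⟩
  have hp0 : (p : ℚ) ≠ 0 := Nat.cast_ne_zero.2 hp.ne_zero
  have h := fiber_card_mul_range_card (dotHom (Ideal.span {(p : ZMod (p ^ r))}) a) t
  have hrange : Nat.card (dotHom (Ideal.span {(p : ZMod (p ^ r))}) a).range =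
      p ^ (r - (j + 1)) := by
    rw [← card_span_pow hp hj]
    exact Nat.card_congr (Equiv.subtypeEquivRight (mem_range_dotHom hp a ha ha'))
  have hdom : Nat.card (Fin k → Ideal.span {(p : ZMod (p ^ r))}) = p ^ ((r - 1) * k) := by
    have h1 := card_span_pow (p := p) (r := r) (j := 1) hp (by omega)
    rw [pow_one] at h1
    rw [Nat.card_fun, h1, Nat.card_fin, pow_mul]
  rw [hrange, hdom] at h
  simp only [mem_range_dotHom hp a ha ha' t] at h
  have hq := congrArg (Nat.cast : ℕ → ℚ) h
  push_cast at hq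
  rw [← eq_div_iff (pow_ne_zero _ hp0)] at hq
  rw [hq]
  split_ifs <;> simp

/-- The extra term is the stratum of vectors of exact order `j`: their number times the common fibre
size. -/
theorem restrictedDotCount_step (hp : p.Prime) {j k : ℕ} (hj0 : 1 ≤ j) (hj : j < r)
    [NeZero (p ^ r)] (t : ZMod (p ^ r)) :
    (restrictedDotCount (Ideal.span {(p : ZMod (p ^ r))})
        (Ideal.span {(p : ZMod (p ^ r)) ^ j}) k t : ℚ) =
      restrictedDotCount (Ideal.span {(p : ZMod (p ^ r))})
        (Ideal.span {(p : ZMod (p ^ r)) ^ (j + 1)}) k t +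
      if t ∈ Ideal.span {(p : ZMod (p ^ r)) ^ (j + 1)} then
        ((p : ℚ) ^ ((r - j) * k) - (p : ℚ) ^ ((r - (j + 1)) * k)) *
          ((p : ℚ) ^ ((r - 1) * k) / (p : ℚ) ^ (r - (j + 1))) else 0 := by
  set I := Ideal.span {(p : ZMod (p ^ r))} with hI
  have hle : ∀ i, 1 ≤ i → Ideal.span {(p : ZMod (p ^ r)) ^ i} ≤ I := fun i hi => by
    have := span_pow_anti (p := p) (r := r) hi
    rwa [pow_one] at this
  set A : Finset (Fin k → I) := {a | ∀ i, (a i : ZMod (p ^ r)) ∈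
    Ideal.span {(p : ZMod (p ^ r)) ^ j}} with hA
  set B : Finset (Fin k → I) := {a | ∀ i, (a i : ZMod (p ^ r)) ∈
    Ideal.span {(p : ZMod (p ^ r)) ^ (j + 1)}} with hB
  have hBA : B ⊆ A := fun a ha => by
    simp only [hA, hB, mem_filter, mem_univ, true_and] at ha ⊢
    exact fun i => span_pow_anti (Nat.le_succ j) (ha i)
  have hcA : (#A : ℚ) = (p : ℚ) ^ ((r - j) * k) := by
    rw [hA, card_filter_forall_mem (hle j hj0), card_span_pow hp hj.le, ← pow_mul, Nat.cast_pow]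
  have hcB : (#B : ℚ) = (p : ℚ) ^ ((r - (j + 1)) * k) := by
    rw [hB, card_filter_forall_mem (hle (j + 1) (by omega)), card_span_pow hp hj, ← pow_mul,
      Nat.cast_pow]
  unfold restrictedDotCount
  rw [← hA, ← hB, ← sum_sdiff hBA, add_comm, Nat.cast_add]
  congr 1
  rw [Nat.cast_sum, sum_congr rfl fun a ha => card_fiber_dotHom (t := t) hp hj _ ?_ ?_]
  · rw [sum_const, card_sdiff_of_subset hBA, nsmul_eq_mul, Nat.cast_sub (card_le_card hBA), hcA,
      hcB, mul_ite, mul_zero]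
  · simp only [hA, hB, mem_sdiff, mem_filter, mem_univ, true_and] at ha
    exact ha.1
  · simp only [hA, hB, mem_sdiff, mem_filter, mem_univ, true_and, not_forall] at ha
    exact ha.2

theorem restrictedDotCount_eq (hp : p.Prime) [NeZero (p ^ r)] {l k : ℕ} (hl : l ≤ r)
    {t u : ZMod (p ^ r)} (hu : IsUnit u) (ht : t = u * (p : ZMod (p ^ r)) ^ l)
    {j : ℕ} (hj : j ≤ r) : 1 ≤ j →
    (restrictedDotCount (Ideal.span {(p : ZMod (p ^ r))})
        (Ideal.span {(p : ZMod (p ^ r)) ^ j}) k t : ℚ) =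
      (if l = r then (p : ℚ) ^ ((r - 1) * k) else 0) +
      ∑ i ∈ Ico j l, ((p : ℚ) ^ ((r - i) * k) - (p : ℚ) ^ ((r - (i + 1)) * k)) *
          ((p : ℚ) ^ ((r - 1) * k) / (p : ℚ) ^ (r - (i + 1))) := by
  have hpr : (p : ZMod (p ^ r)) ^ r = 0 := by
    rw [← Nat.cast_pow, ZMod.natCast_self]
  -- Descend from `j = r`, where `p^r = 0` leaves only the zero vector, which contributes exactly
  -- when `t = 0`.
  induction hj using Nat.decreasingInduction with
  | self =>
    intro hr
    have htz : t = 0 ↔ l = r := by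
      rw [← Ideal.mem_bot, ← Ideal.span_singleton_eq_bot.2 hpr,
        pow_mem_span_pow_iff hp hl le_rfl hu ht]
      omega
    have h1 := card_span_pow (p := p) (r := r) (j := 1) hp hr
    rw [pow_one] at h1
    rw [Ico_eq_empty_of_le hl, sum_empty, add_zero, hpr]
    unfold restrictedDotCount
    have : ({a | ∀ i, (a i : ZMod (p ^ r)) ∈ Ideal.span {(0 : ZMod (p ^ r))}} :
        Finset (Fin k → Ideal.span {(p : ZMod (p ^ r))})) = {0} := by
      ext a
      simp [funext_iff]
    rw [this, sum_singleton]
    split_ifs with h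
    · rw [htz.2 h, Nat.card_congr (Equiv.subtypeUnivEquiv fun v => by simp [dotHom]),
        Nat.card_fun, h1, Nat.card_fin, ← pow_mul, Nat.cast_pow]
    · rw [← htz] at h
      have : IsEmpty {v // dotHom (Ideal.span {(p : ZMod (p ^ r))})
          (fun i => (((0 : Fin k → Ideal.span {(p : ZMod (p ^ r))}) i) : ZMod (p ^ r))) v = t} :=
        ⟨fun v => h (by rw [← v.2]; simp [dotHom])⟩
      simp
  | of_succ j hj ih =>
    intro hj0
    rw [restrictedDotCount_step hp hj0 hj, ih (by omega),
      if_congr (pow_mem_span_pow_iff hp hl hj hu ht) rfl rfl, add_assoc]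
    congr 1
    split_ifs with h
    · rw [sum_eq_sum_Ico_succ_bot h, add_comm]
    · rw [Ico_eq_empty_of_le (by omega), Ico_eq_empty_of_le (by omega)]
      simp

theorem ncard_sigmaSet {R : Type*} [CommRing R] [Fintype R] (I : Ideal R) (n : ℕ) (u : Rˣ) :
    (sigmaSet I n (u : R)).ncard = wordCount I n (lam u) := by
  have hlam : ∀ c : Fin n → R, (∃ v : Rˣ, (v : R) = u ∧ etaProd c = lam v) ↔
      etaProd c = lam u := fun c =>
    ⟨fun ⟨v, hv, h⟩ => by rwa [Units.ext hv] at h, fun h => ⟨u, rfl, h⟩⟩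
  unfold wordCount
  rw [← card_filter, ← Fintype.card_subtype, ← Nat.card_eq_fintype_card, ← Nat.card_coe_set_eq]
  exact Nat.card_congr
    { toFun := fun c => ⟨fun i => ⟨c.1 i, c.2.1 i⟩, (hlam _).1 c.2.2⟩
      invFun := fun c => ⟨fun i => c.1 i, fun i => (c.1 i).2, (hlam _).2 c.2⟩
      left_inv := fun _ => rfl
      right_inv := fun _ => rfl }

theorem isUnit_one_add_of_mem {x : ZMod (p ^ r)}
    (hx : x ∈ Ideal.span {(p : ZMod (p ^ r))}) : IsUnit (1 + x) := by
  obtain ⟨y, rfl⟩ := Ideal.mem_span_singleton.1 hx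
  refine IsNilpotent.isUnit_one_add ⟨r, ?_⟩
  rw [mul_pow, ← Nat.cast_pow, ZMod.natCast_self, zero_mul]

theorem sigma_two_mul_succ (hp : p.Prime) {l : ℕ} (hl1 : 1 ≤ l) (hl : l ≤ r) (k : ℕ) :
    (sigma p r (2 * (k + 1)) l : ℚ) =
      (if l = r then (p : ℚ) ^ ((r - 1) * k) else 0) +
      ∑ i ∈ Ico 1 l, ((p : ℚ) ^ ((r - i) * k) - (p : ℚ) ^ ((r - (i + 1)) * k)) *
          ((p : ℚ) ^ ((r - 1) * k) / (p : ℚ) ^ (r - (i + 1))) := by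
  have : NeZero (p ^ r) := ⟨(pow_pos hp.pos r).ne'⟩
  set P : ZMod (p ^ r) := (p : ZMod (p ^ r)) with hP
  set ε : ZMod (p ^ r) := (-1) ^ (k + 1) with hε
  have hεε : ε * ε = 1 := by rw [hε, ← mul_pow]; simp
  have hPl : P ^ l ∈ Ideal.span {P} :=
    Ideal.mem_span_singleton.2 (dvd_pow_self _ (by omega))
  have hz : IsUnit (ε + P ^ l) := by
    have h1 := isUnit_one_add_of_mem (Ideal.mul_mem_left _ ε hPl)
    refine isUnit_of_mul_isUnit_right (x := ε) ?_
    rwa [mul_add, hεε]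
  obtain ⟨z, hz⟩ := hz
  set w : ZMod (p ^ r) := ((z⁻¹ : (ZMod (p ^ r))ˣ) : ZMod (p ^ r)) with hw
  have hzw : (z : ZMod (p ^ r)) * w = 1 := z.mul_inv
  -- Since `z = ε + p^l`, one has `ε z⁻¹ - 1 = (ε - z) z⁻¹`.
  have ht : ε * w - 1 = -w * P ^ l := by
    rw [hz] at hzw
    linear_combination hzw
  have h11 : ε * lam z 1 1 - 1 = -w * P ^ l := ht
  unfold sigma
  rw [Nat.mul_div_cancel_left _ two_pos, ← hz, ncard_sigmaSet,
    wordCount_two_mul_add_two _ (fun x hx => isUnit_one_add_of_mem hx), h11,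
    ← restrictedDotCount_self]
  · have := restrictedDotCount_eq hp hl (k := k) (Units.isUnit z⁻¹).neg
      (t := -w * P ^ l) rfl (j := 1) (by omega) le_rfl
    rw [pow_one] at this
    exact this
  · rw [lam, Matrix.det_fin_two_of]
    simp
  · exact Ideal.zero_mem _
  · exact Ideal.zero_mem _
  · rw [h11]
    exact Ideal.mul_mem_left _ _ hPl

end PrimePower

/-! ### Geometric sums and the closed formulas -/

theorem sum_Ico_inv_pow {q : ℚ} (hq : q ≠ 1) (hq0 : q ≠ 0) {l : ℕ} (hl : 1 ≤ l) :
    ∑ i ∈ Ico 1 l, (q ^ i)⁻¹ = (q ^ (l - 1))⁻¹ * qInt q ((l : ℤ) - 1) := by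
  have hq' : q - 1 ≠ 0 := sub_ne_zero.2 hq
  induction l, hl using Nat.le_induction with
  | base => simp [qInt]
  | succ l hl ih =>
    obtain ⟨l, rfl⟩ : ∃ m, l = m + 1 := ⟨l - 1, by omega⟩
    rw [sum_Ico_succ_top hl, ih]
    simp only [qInt]
    push_cast
    simp only [add_sub_cancel_right]
    rw [← Nat.cast_one (R := ℤ), ← Nat.cast_add, zpow_natCast, zpow_natCast]
    field_simp
    ring

theorem mul_qInt_sub_one {q : ℚ} (hq : q ≠ 1) (hq0 : q ≠ 0) (k : ℤ) :
    q * qInt q (k - 1) = qInt q k - 1 := by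
  have hq' : q - 1 ≠ 0 := sub_ne_zero.2 hq
  simp only [qInt]
  rw [zpow_sub_one₀ hq0]
  field_simp
  ring

theorem sigma_two_mul_add_two {p r l : ℕ} (hp : p.Prime) (hl1 : 1 ≤ l) (hl : l ≤ r) (k : ℕ) :
    (sigma p r (2 * (k + 1 + 1)) l : ℚ) =
      (if l = r then (p : ℚ) ^ ((r - 1) * (k + 1)) else 0) +
      ((p : ℚ) ^ (k + 1) - 1) * (p : ℚ) ^ ((r - 1) * (2 * k + 1)) *
        ∑ i ∈ Ico 1 l, (((p : ℚ) ^ k) ^ i)⁻¹ := by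
  have hp0 : (p : ℚ) ≠ 0 := Nat.cast_ne_zero.2 hp.ne_zero
  rw [sigma_two_mul_succ hp hl1 hl, mul_sum]
  congr 1
  refine sum_congr rfl fun i hi => ?_
  obtain ⟨hi1, hi2⟩ := mem_Ico.1 hi
  obtain ⟨i, rfl⟩ := Nat.exists_eq_add_of_le' hi1
  obtain ⟨s, rfl⟩ : ∃ s, r = s + (i + 1 + 1) := Nat.exists_eq_add_of_le' (by omega)
  rw [show s + (i + 1 + 1) - (i + 1) = s + 1 by omega,
    show s + (i + 1 + 1) - (i + 1 + 1) = s by omega,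
    show s + (i + 1 + 1) - 1 = s + i + 1 by omega]
  field_simp
  ring

end Quiddity

theorem mainTheorem3 (p r ℓ : ℕ) (hp : p.Prime) (hℓ : 1 ≤ ℓ) (hℓr : ℓ ≤ r) :
    -- length 2
    (Quiddity.sigma p r 2 ℓ = if ℓ = r then 1 else 0) ∧
    -- length 4
    (ℓ = 1 → ℓ < r → Quiddity.sigma p r 4 ℓ = 0) ∧
    (1 < ℓ → ℓ < r →
      (Quiddity.sigma p r 4 ℓ : ℤ) = ((ℓ : ℤ) - 1) * ((p : ℤ) ^ r - (p : ℤ) ^ (r - 1))) ∧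
    (ℓ = r →
      (Quiddity.sigma p r 4 ℓ : ℤ) =
        ((r : ℤ) - 1) * (p : ℤ) ^ r - ((r : ℤ) - 2) * (p : ℤ) ^ (r - 1)) ∧
    -- length 2m with m > 2
    (∀ m : ℕ, 2 < m →
      (ℓ = 1 → ℓ < r → Quiddity.sigma p r (2 * m) ℓ = 0) ∧
      (1 < ℓ → ℓ < r →
        (Quiddity.sigma p r (2 * m) ℓ : ℚ) =
          (p : ℚ) ^ ((2 * (m : ℤ) - 3) * (r : ℤ) - (ℓ : ℤ) * ((m : ℤ) - 2) + 1 - (m : ℤ)) *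
            ((p : ℚ) ^ (m - 1) - 1) *
            Quiddity.qInt ((p : ℚ) ^ (m - 2)) ((ℓ : ℤ) - 1)) ∧
      (ℓ = r →
        (Quiddity.sigma p r (2 * m) ℓ : ℚ) =
          (p : ℚ) ^ (((m : ℤ) - 1) * (r : ℤ)) *
              Quiddity.qInt ((p : ℚ) ^ (m - 2)) ((r : ℤ) - 1) -
            (p : ℚ) ^ (((m : ℤ) - 1) * (r : ℤ) - 1) *
              Quiddity.qInt ((p : ℚ) ^ (m - 2)) ((r : ℤ) - 2))) := by
  have hp0 : (p : ℚ) ≠ 0 := Nat.cast_ne_zero.2 hp.ne_zero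
  obtain ⟨s, rfl⟩ := Nat.exists_eq_add_of_le' (hℓ.trans hℓr)
  have h4 : (Quiddity.sigma p (s + 1) 4 ℓ : ℚ) = (if ℓ = s + 1 then (p : ℚ) ^ s else 0) +
      ((p : ℚ) - 1) * (p : ℚ) ^ s * ((ℓ : ℚ) - 1) := by
    -- Here the ratio `p^0` is 1, so the sum is `ℓ - 1`; this is why length 4 stands apart.
    have := Quiddity.sigma_two_mul_add_two hp hℓ hℓr 0
    simpa [Nat.cast_sub hℓ] using this
  refine ⟨?_, fun h1 h2 => ?_, fun h1 h2 => ?_, fun h => ?_, fun m hm => ?_⟩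
  · have := Quiddity.sigma_two_mul_succ hp hℓ hℓr 0
    rw [← Nat.cast_inj (R := ℚ)]
    simpa using this
  · rw [← Nat.cast_inj (R := ℚ), h4, if_neg h2.ne, h1]
    simp
  · have : (Quiddity.sigma p (s + 1) 4 ℓ : ℚ) =
        ((ℓ : ℚ) - 1) * ((p : ℚ) ^ (s + 1) - (p : ℚ) ^ s) := by
      rw [h4, if_neg h2.ne]
      ring
    exact_mod_cast this
  · have : (Quiddity.sigma p (s + 1) 4 ℓ : ℚ) = (((s + 1 : ℕ) : ℚ) - 1) * (p : ℚ) ^ (s + 1) -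
        (((s + 1 : ℕ) : ℚ) - 2) * (p : ℚ) ^ s := by
      rw [h4, if_pos h, h]
      push_cast
      ring
    exact_mod_cast this
  · obtain ⟨k, rfl⟩ := Nat.exists_eq_add_of_lt hm
    have hq0 : (p : ℚ) ^ (k + 1) ≠ 0 := pow_ne_zero _ hp0
    have hq1 : (p : ℚ) ^ (k + 1) ≠ 1 :=
      (one_lt_pow₀ (by exact_mod_cast hp.one_lt) (Nat.succ_ne_zero k)).ne'
    have hσ : (Quiddity.sigma p (s + 1) (2 * (2 + k + 1)) ℓ : ℚ) =
        (if ℓ = s + 1 then (p : ℚ) ^ (s * (k + 2)) else 0) +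
        ((p : ℚ) ^ (k + 2) - 1) * (p : ℚ) ^ (s * (2 * k + 3)) *
          (((p : ℚ) ^ (k + 1)) ^ (ℓ - 1))⁻¹ *
            Quiddity.qInt ((p : ℚ) ^ (k + 1)) ((ℓ : ℤ) - 1) := by
      rw [show 2 + k + 1 = k + 1 + 1 + 1 by ring, Quiddity.sigma_two_mul_add_two hp hℓ hℓr,
        Quiddity.sum_Ico_inv_pow hq1 hq0 hℓ]
      simp only [Nat.add_sub_cancel]
      ring
    rw [show 2 + k + 1 - 1 = k + 2 by omega, show 2 + k + 1 - 2 = k + 1 by omega]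
    refine ⟨fun h1 h2 => ?_, fun h1 h2 => ?_, fun h => ?_⟩
    · rw [← Nat.cast_inj (R := ℚ), hσ, if_neg h2.ne, h1]
      simp [Quiddity.qInt]
    · rw [hσ, if_neg h2.ne, zero_add]
      congr 1
      obtain ⟨l, rfl⟩ := Nat.exists_eq_add_of_le' hℓ
      have e : (p : ℚ) ^ ((2 * ((2 + k + 1 : ℕ) : ℤ) - 3) * ((s + 1 : ℕ) : ℤ) -
          ((l + 1 : ℕ) : ℤ) * (((2 + k + 1 : ℕ) : ℤ) - 2) + 1 - ((2 + k + 1 : ℕ) : ℤ)) =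
          (p : ℚ) ^ (s * (2 * k + 3)) * ((p : ℚ) ^ ((k + 1) * l))⁻¹ := by
        rw [← zpow_natCast, ← zpow_natCast, ← zpow_neg, ← zpow_add₀ hp0]
        congr 1
        push_cast
        ring
      rw [e, Nat.add_sub_cancel, pow_mul]
      ring
    · subst h
      rw [hσ, if_pos rfl]
      have e₁ : (p : ℚ) ^ ((((2 + k + 1 : ℕ) : ℤ) - 1) * ((s + 1 : ℕ) : ℤ)) =
          (p : ℚ) ^ (s * (k + 2)) * (p : ℚ) ^ (k + 2) := by
        rw [← pow_add, ← zpow_natCast]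
        congr 1
        push_cast
        ring
      have e₂ : (p : ℚ) ^ ((((2 + k + 1 : ℕ) : ℤ) - 1) * ((s + 1 : ℕ) : ℤ) - 1) =
          (p : ℚ) ^ (s * (k + 2)) * (p : ℚ) ^ (k + 1) := by
        rw [← pow_add, ← zpow_natCast]
        congr 1
        push_cast
        ring
      have e₃ : (p : ℚ) ^ (s * (2 * k + 3)) * (((p : ℚ) ^ (k + 1)) ^ (s + 1 - 1))⁻¹ =
          (p : ℚ) ^ (s * (k + 2)) := by
        rw [mul_inv_eq_iff_eq_mul₀ (pow_ne_zero _ hq0), Nat.add_sub_cancel]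
        ring
      -- With `q = p^(m-2)`, the identity `q [r-2]_q = [r-1]_q - 1` absorbs the contribution of the
      -- zero vector.
      have e₄ := Quiddity.mul_qInt_sub_one hq1 hq0 (((s + 1 : ℕ) : ℤ) - 1)
      rw [sub_sub, one_add_one_eq_two] at e₄
      rw [e₁, e₂, mul_assoc _ ((p : ℚ) ^ (k + 1)), e₄, mul_assoc ((p : ℚ) ^ (k + 2) - 1), e₃]
      ring
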